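/- Let $X$ be a projective manifold (smooth, irreducible projective variety over $\mathbb C$) of dimension $n$, with function field $\mathbb C(X)$, and let $\mathfrak g$ be a Lie subalgebra, over $\mathbb C$, of the Lie algebra of rational vector fields on $X$, i.e. of $\mathbb C$-derivations of $\mathbb C(X)$. For a point $p$ of $X$, let $\mathfrak h_p\subset\mathfrak g$ be the isotropy subalgebra of vector fields in $\mathfrak g$ vanishing at $p$; "general point" means any (closed) point of some non-empty Zariski open set. Assume that: (a) $\mathfrak g$ is non-abelian and primitive: $\mathfrak g$ is finite-dimensional, it contains a basis of the $\mathbb C(X)$-vector space of rational vector fields on $X$ (transitivity), and for general $p$ the isotropy subalgebra $\mathfrak h_p$ is maximal among the proper Lie subalgebras of $\mathfrak g$; (b) $\mathfrak g$ is of affine type: for general $p$ one has $\mathfrak g=\mathfrak h_p\ltimes\mathfrak m$ for an ideal $\mathfrak m$ of $\mathfrak g$ with $[\mathfrak m,\mathfrak m]=0$, where $\mathfrak m$ is an irreducible and faithful $\mathfrak h_p$-module and $\mathfrak h_p$ is the direct sum of a semisimple Lie algebra and a Lie algebra of dimension at most one. Then there is one ideal $\mathfrak m$ of $\mathfrak g$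 which has the properties in (b) for every general $p$; it has dimension $n$. For any basis $v_1,\dots,v_n$ of $\mathfrak m$ put $\Theta_0=v_1\wedge\cdots\wedge v_n$, and let $V\subset\mathbb C(X)$ be the $\mathbb C$-span of the rational functions $\dfrac{\theta\wedge w}{\Theta_0}$ with $\theta=u_1\wedge\cdots\wedge u_{n-1}$, $u_i\in\mathfrak m$, and $w\in\mathfrak g$. Then $V$ contains the constants, $\dim_{\mathbb C}V=n+1$, and $v(V)\subset V$ for all $v\in\mathfrak g$. Moreover, there is a dominant rational map $\varphi=(\varphi_1,\dots,\varphi_n):X\dashrightarrow\mathbb C^n$, with $1,\varphi_1,\dots,\varphi_n$ spanning $V$, which conjugates $\mathfrak g$ to a Lie algebra $\mathfrak a$ of polynomial vector fields of degree at most one on $\mathbb C^n$: there is a Lie algebra isomorphism $e:\mathfrak g\to\mathfrak a$ such that $v(P\circ\varphi)=(e(v)P)\circ\varphi$ for all $v\in\mathfrak g$ and all $P\in\mathbb C[x_1,\dots,x_n]$. -/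

import Mathlib

open AlgebraicGeometry CategoryTheory

noncomputable section

namespace RatVF

/-- The base scheme `Spec ℂ`. -/
abbrev SpecC : Scheme.{0} := Spec (CommRingCat.of ℂ)

/-- The homogeneous parts of `ℂ[x₀, …, x_N]`. -/
abbrev homPart (N : ℕ) : ℕ → Submodule ℂ (MvPolynomial (Fin (N + 1)) ℂ) :=
  MvPolynomial.homogeneousSubmodule (Fin (N + 1)) ℂ

instance gradedRingHomPart (N : ℕ) : GradedRing (homPart N) :=
  MvPolynomial.gradedAlgebra

/-- The structure morphism of the complex projective space `ℙ^N = Proj ℂ[x₀, …, x_N]`. -/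
def projectiveSpaceToSpecC (N : ℕ) : Proj (homPart N) ⟶ SpecC :=
  Proj.toSpecZero (homPart N) ≫
    Spec.map (CommRingCat.ofHom (algebraMap ℂ (homPart N 0)))

/-- A `ℂ`-scheme is projective if it is a closed subscheme of some `ℙ^N` over `ℂ`. -/
def IsProjective (X : Scheme.{0}) [X.Over SpecC] : Prop :=
  ∃ (N : ℕ) (i : X ⟶ Proj (homPart N)),
    IsClosedImmersion i ∧ i ≫ projectiveSpaceToSpecC N = X ↘ SpecC

/-- The field of rational functions `ℂ(X)`. -/
abbrev RatFun (X : Scheme.{0}) [IsIntegral X] : Type := X.functionField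

/-- The inclusion of the constants `ℂ → ℂ(X)`, induced by the structure morphism of `X`. -/
def constants (X : Scheme.{0}) [IsIntegral X] [X.Over SpecC] : ℂ →+* RatFun X :=
  ((Scheme.ΓSpecIso (CommRingCat.of ℂ)).inv ≫ (X ↘ SpecC).appTop ≫
    X.presheaf.germ ⊤ (genericPoint X) trivial).hom

instance algebraRatFun (X : Scheme.{0}) [IsIntegral X] [X.Over SpecC] : Algebra ℂ (RatFun X) :=
  (constants X).toAlgebra

section VectorFields

variable (X : Scheme.{0}) [IsIntegral X] [X.Over SpecC]

/-- The Lie algebra of rational vector fields on `X`: the `ℂ`-derivations of `ℂ(X)`. -/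
abbrev RatVectorField : Type := Derivation ℂ (RatFun X) (RatFun X)

variable {X}

/-- A rational vector field vanishes at `p` if it maps the local ring of `p` into the maximal
ideal of `p` (in particular it is then regular at `p`). -/
def VanishesAt (v : RatVectorField X) (p : X) : Prop :=
  ∀ s : X.presheaf.stalk p, ∃ t ∈ IsLocalRing.maximalIdeal (X.presheaf.stalk p),
    v (algebraMap (X.presheaf.stalk p) (RatFun X) s) =
      algebraMap (X.presheaf.stalk p) (RatFun X) t

/-- `P` holds at every sufficiently general (closed) point of `X`. -/
def ForGeneralPoint (P : X → Prop) : Prop :=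
  ∃ U : X.Opens, (U : Set X).Nonempty ∧ ∀ p ∈ U, IsClosed ({p} : Set X) → P p

/-- The constants lie in every local ring. -/
theorem exists_constants_eq (p : X) (c : ℂ) :
    ∃ s : X.presheaf.stalk p,
      algebraMap (X.presheaf.stalk p) (RatFun X) s = algebraMap ℂ (RatFun X) c := by
  refine ⟨X.presheaf.germ ⊤ p trivial
    ((X ↘ SpecC).appTop.hom ((Scheme.ΓSpecIso (CommRingCat.of ℂ)).inv.hom c)), ?_⟩
  have : Nonempty (⊤ : X.Opens) := ⟨⟨p, trivial⟩⟩
  exact Scheme.algebraMap_germ_eq_germToFunctionField X (U := ⊤) trivial _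

/-- The isotropy subalgebra `𝔥_p` of `𝔤` at `p`: the elements of `𝔤` vanishing at `p`. -/
def isotropy (g : LieSubalgebra ℂ (RatVectorField X)) (p : X) : LieSubalgebra ℂ g where
  carrier := {v | VanishesAt (v : RatVectorField X) p}
  add_mem' := by
    intro v w hv hw s
    obtain ⟨t, ht, hvt⟩ := hv s
    obtain ⟨u, hu, hwu⟩ := hw s
    exact ⟨t + u, Ideal.add_mem _ ht hu, by simp [hvt, hwu]⟩
  zero_mem' := fun s => ⟨0, Ideal.zero_mem _, by simp⟩
  smul_mem' := by
    intro c v hv s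
    obtain ⟨t, ht, hvt⟩ := hv s
    obtain ⟨r, hr⟩ := exists_constants_eq p c
    exact ⟨r * t, Ideal.mul_mem_left _ _ ht, by simp [hvt, hr, Algebra.smul_def]⟩
  lie_mem' := by
    intro v w hv hw s
    obtain ⟨t, -, hvt⟩ := hv s
    obtain ⟨u, -, hwu⟩ := hw s
    obtain ⟨t', ht', hvt'⟩ := hv u
    obtain ⟨u', hu', hwu'⟩ := hw t
    exact ⟨t' - u', Ideal.sub_mem _ ht' hu', by
      simp [Derivation.commutator_apply, hvt, hwu, hvt', hwu']⟩

/-- `𝔤` is transitive: it contains a basis of the `ℂ(X)`-vector space of rational vector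
fields. -/
def IsTransitive (g : LieSubalgebra ℂ (RatVectorField X)) : Prop :=
  Submodule.span (RatFun X) (g : Set (RatVectorField X)) = ⊤

/-- A primitive Lie algebra of rational vector fields: finite-dimensional, transitive, and its
isotropy subalgebra at a general point is maximal among the proper Lie subalgebras. -/
structure IsPrimitive (g : LieSubalgebra ℂ (RatVectorField X)) : Prop where
  finiteDimensional : FiniteDimensional ℂ g
  transitive : IsTransitive g
  maximal : ForGeneralPoint fun p : X => IsCoatom (isotropy g p)

end VectorFields

/-- `L = 𝔥 ⋉ 𝔪` is a decomposition of affine type of the Lie algebra `L`: the ideal `𝔪` is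
abelian and complementary to the subalgebra `𝔥`, as an `𝔥`-module it is irreducible and faithful,
and `𝔥` is the direct sum of a semisimple Lie algebra and a Lie algebra of dimension at most
one. -/
structure IsAffineDecomposition {L : Type*} [LieRing L] [LieAlgebra ℂ L]
    (h : LieSubalgebra ℂ L) (m : LieIdeal ℂ L) : Prop where
  isCompl : IsCompl h.toSubmodule m.toSubmodule
  abelian : ∀ x ∈ m, ∀ y ∈ m, ⁅x, y⁆ = 0
  irreducible : LieModule.IsIrreducible ℂ h m
  faithful : ∀ x ∈ h, (∀ y ∈ m, ⁅x, y⁆ = 0) → x = 0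
  reductive : ∃ s z : LieIdeal ℂ h, IsCompl s z ∧
    LieAlgebra.IsSemisimple ℂ s ∧ FiniteDimensional ℂ z ∧ Module.finrank ℂ z ≤ 1

section Normalization

variable {X : Scheme.{0}} [IsIntegral X] [X.Over SpecC]

/-- `𝔤` is of affine type: at a general point `p` there is a decomposition `𝔤 = 𝔥_p ⋉ 𝔪` of affine
type. -/
def IsOfAffineType (g : LieSubalgebra ℂ (RatVectorField X)) : Prop :=
  ForGeneralPoint fun p : X => ∃ m : LieIdeal ℂ g, IsAffineDecomposition (isotropy g p) m

/-- For a basis `b` of `𝔪`, with determinant `Θ₀ = b₁ ∧ ⋯ ∧ bₙ`, the complex span of all rational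
functions `(θ ∧ w) / Θ₀`, where `θ = u₁ ∧ ⋯ ∧ uₙ₋₁` with `uᵢ ∈ 𝔪` and `w ∈ 𝔤`; the wedge products
are those of multivector fields with coefficients in `ℂ(X)`. -/
def wedgeQuotients (g : LieSubalgebra ℂ (RatVectorField X)) {m : LieIdeal ℂ g} {n : ℕ}
    (b : Module.Basis (Fin n) ℂ m) : Submodule ℂ (RatFun X) :=
  Submodule.span ℂ {f | ∃ (u : Fin (n - 1) → m) (w : g),
    ExteriorAlgebra.ιMulti (RatFun X) (n - 1) (fun i => ((u i : g) : RatVectorField X)) *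
        ExteriorAlgebra.ι (RatFun X) (w : RatVectorField X) =
      f • ExteriorAlgebra.ιMulti (RatFun X) n (fun i => ((b i : g) : RatVectorField X))}

/-- The `i`-th entry of a rational map to affine space, as a rational function. -/
def entry {n : ℕ} (φ : X ⤏ 𝔸(Fin n; SpecC)) (i : Fin n) : RatFun X :=
  (Scheme.ΓSpecIso X.functionField).hom.hom
    (φ.fromFunctionField.appTop.hom (AffineSpace.coord SpecC i))

/-- The pull-back of polynomial functions under a rational map to affine space. -/
def pullback {n : ℕ} (φ : X ⤏ 𝔸(Fin n; SpecC)) : MvPolynomial (Fin n) ℂ →ₐ[ℂ] RatFun X :=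
  MvPolynomial.aeval (entry φ)

/-- The Lie algebra of polynomial vector fields on `ℂⁿ`. -/
abbrev PolyVectorField (n : ℕ) : Type :=
  Derivation ℂ (MvPolynomial (Fin n) ℂ) (MvPolynomial (Fin n) ℂ)

/-- The polynomial vector field `∑ Pᵢ ∂/∂xᵢ` has degree at most `d` if all `Pᵢ` do. -/
def PolyVectorField.DegreeLE {n : ℕ} (D : PolyVectorField n) (d : ℕ) : Prop :=
  ∀ i, (D (MvPolynomial.X i)).totalDegree ≤ d

/-- `φ` conjugates `𝔤` to the Lie algebra `𝔞` of polynomial vector fields: `φ` is dominant, and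
there is an isomorphism `e : 𝔤 ≃ 𝔞` such that every `v ∈ 𝔤` is `φ`-related to `e v`, i.e.
`v (P ∘ φ) = (e v) P ∘ φ` for all polynomials `P`. -/
def Conjugates {n : ℕ} (φ : X ⤏ 𝔸(Fin n; SpecC)) (g : LieSubalgebra ℂ (RatVectorField X))
    (a : LieSubalgebra ℂ (PolyVectorField n)) : Prop :=
  φ.IsDominant ∧ ∃ e : g ≃ₗ⁅ℂ⁆ a, ∀ (v : g) (P : MvPolynomial (Fin n) ℂ),
    (v : RatVectorField X) (pullback φ P) = pullback φ ((e v : PolyVectorField n) P)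

end Normalization

end RatVF

end

open RatVF

/-! The ideal `𝔪` plays the part of the constant vector fields on affine space. It equals its own
centralizer (faithfulness) and is a minimal ideal (irreducibility), hence is the same for all
general `p` (`ideal_unique`).

A basis `b` of `𝔪` is a frame of the rational vector fields. A relation `∑ fᵢ bᵢ = 0` over the
function field, evaluated at a general `p`, gives the element `∑ fᵢ(p) bᵢ` of `𝔪 ∩ 𝔥_p = 0`, so `dim
𝔪 ≤ n` (`linearIndependent_ratFun`); transitivity gives the reverse inequality
(`finrank_le_finrank_ideal`). By Cramer's rule `V` is the span of the coordinates `wᵢ` in this frame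
of all `w ∈ 𝔤` (`wedgeQuotients_eq_coordinateSpan`).

Since the frame commutes, `[bⱼ, w] = ∑ bⱼ(wᵢ) bᵢ`; this lies in `𝔪`, so every `bⱼ(wᵢ)` is constant:
elements of `V` are "affine functions", and `V` is `𝔤`-stable. The elements of `𝔪` killing `V` form
an ideal of `𝔤`. If it were `𝔪`, all coordinates would be constant and `𝔤 = 𝔪` abelian; so it is
zero. Dually, `f ↦ (bⱼ f)ⱼ` maps `V` onto `ℂⁿ`, with kernel the constants. Preimages `φᵢ` of the
standard basis are algebraically independent and span `V` together with `1`, so `𝔤` acts on them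
through polynomial fields of degree at most one. -/

open scoped TensorProduct

/-! ### Derivations and differentials of function fields -/

/-- A function annihilated by all derivations of a finitely generated field extension of `ℂ` is
constant. -/
theorem exists_algebraMap_eq_of_forall_derivation_eq_zero {K : Type} [Field K] [Algebra ℂ K]
    [Algebra.EssFiniteType ℂ K] (f : K) (h : ∀ D : Derivation ℂ K K, D f = 0) :
    ∃ c, algebraMap ℂ K c = f := by
  by_contra hc
  have htr : Transcendental ℂ f := fun halg ↦ hc <| minpoly.mem_range_of_degree_eq_one ℂ f
    (IsAlgClosed.degree_eq_one_of_irreducible ℂ (minpoly.irreducible halg.isIntegral))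
  let A := Polynomial ℂ
  algebraize [(Polynomial.aeval f : A →ₐ[ℂ] K).toRingHom]
  have hX : algebraMap A K Polynomial.X = f := Polynomial.aeval_X f
  have : IsScalarTower ℂ A K := .of_algebraMap_eq fun c ↦ (Polynomial.aeval_C f c).symm
  have hinj : Function.Injective (algebraMap A K) := transcendental_iff_injective.mp htr
  have : FaithfulSMul A K := (faithfulSMul_iff_algebraMap_injective A K).mpr hinj
  let L := FractionRing A
  let : Algebra L K := FractionRing.liftAlgebra A K
  have : IsScalarTower A L K := inferInstance
  have : IsScalarTower ℂ L K := .of_algebraMap_eq fun c ↦ by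
    rw [IsScalarTower.algebraMap_apply ℂ A K, IsScalarTower.algebraMap_apply ℂ A L,
      ← IsScalarTower.algebraMap_apply A L K]
  have : Algebra.EssFiniteType L K := .of_comp ℂ L K
  have : CharZero L := algebraRat.charZero L
  have : Algebra.FormallySmooth A L := .of_isLocalization (nonZeroDivisors A)
  -- In characteristic zero `K` is formally smooth over `L = ℂ(f)`, and `L` is a localization of `A
  -- = ℂ[X]`. Hence the first cotangent homology of `K` over `A` vanishes, and `dX ↦ df` induces an
  -- injection `K ⊗ Ω_A → Ω_K`.
  have : Algebra.FormallySmooth A K := .comp A L K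
  have hker : Function.Injective (KaehlerDifferential.mapBaseChange ℂ A K) := by
    rw [injective_iff_map_eq_zero]
    intro x hx
    obtain ⟨y, rfl⟩ := (Algebra.H1Cotangent.exact_δ_mapBaseChange ℂ A K x).mp hx
    rw [Subsingleton.elim y 0, map_zero]
  -- Linear functionals on `Ω_K` are derivations of `K`, and all of these kill `f`.
  have hdf : KaehlerDifferential.D ℂ K f = 0 := by
    rw [← Module.forall_dual_apply_eq_zero_iff K]
    intro φ
    exact h (φ.compDer (KaehlerDifferential.D ℂ K))
  have h0 : (1 : K) ⊗ₜ[A] KaehlerDifferential.D ℂ A Polynomial.X = 0 := hker (by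
    rw [KaehlerDifferential.mapBaseChange_tmul, KaehlerDifferential.map_D, hX, hdf]; simp)
  have h1 := congrArg ((KaehlerDifferential.polynomialEquiv ℂ).toLinearMap.lTensor K) h0
  have h2 : (1 : K) ⊗ₜ[A] (1 : A) = 0 := by
    rw [LinearMap.lTensor_tmul, map_zero] at h1
    rw [← h1]
    exact congrArg _ (((KaehlerDifferential.polynomialEquiv_D ℂ Polynomial.X).trans
      Polynomial.derivative_X).symm)
  simpa using congrArg (TensorProduct.rid A K) h2

theorem finrank_derivation_of_isStandardSmooth {A K : Type} [CommRing A] [Nontrivial A]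
    [Algebra ℂ A]
    [Field K] [Algebra ℂ K] [Algebra A K] [IsScalarTower ℂ A K] [IsFractionRing A K] (n : ℕ)
    [Algebra.IsStandardSmoothOfRelativeDimension n ℂ A] :
    Module.finrank K (Derivation ℂ K K) = n ∧ Module.Finite K (Derivation ℂ K K) := by
  have : Algebra.IsStandardSmooth ℂ A := 
    Algebra.IsStandardSmoothOfRelativeDimension.isStandardSmooth n
  have : Algebra.FormallyEtale A K := .of_isLocalization (nonZeroDivisors A)
  let e := KaehlerDifferential.tensorKaehlerEquivOfFormallyEtale ℂ A K
  have h1 : Module.finrank A Ω[A⁄ℂ] = n := Module.finrank_eq_of_rank_eq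
    (Algebra.IsStandardSmoothOfRelativeDimension.rank_kaehlerDifferential n)
  have h2 : Module.finrank K Ω[K⁄ℂ] = n := by
    rw [← e.finrank_eq, Module.finrank_baseChange, h1]
  have : Module.Finite K Ω[K⁄ℂ] := Module.Finite.equiv e
  let e' := KaehlerDifferential.linearMapEquivDerivation ℂ K (M := K)
  refine ⟨?_, Module.Finite.equiv e'⟩
  rw [← e'.finrank_eq, ← h2]
  exact Subspace.dual_finrank_eq

/-! ### Algebraic independence from dual derivations -/

section AlgebraicIndependence

open MvPolynomial

variable {K : Type*} [Field K] [Algebra ℂ K] {ι : Type*}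

/-- A polynomial all of whose partial derivatives vanish is constant. -/
theorem MvPolynomial.eq_C_of_forall_pderiv_eq_zero {P : MvPolynomial ι ℂ}
    (h : ∀ i, pderiv i P = 0) : P = C (coeff 0 P) := by
  classical
  ext m
  rw [coeff_C]
  split_ifs with hm
  · rw [hm]
  · obtain ⟨i, hi⟩ : ∃ i, m i ≠ 0 := by
      by_contra! hc
      exact hm (Finsupp.ext hc).symm
    have h1 := congrArg (coeff (m - Finsupp.single i 1)) (h i)
    rw [coeff_pderiv, coeff_zero, mul_eq_zero] at h1
    rcases h1 with h1 | h1
    · rwa [tsub_add_cancel_of_le (by simpa [Nat.one_le_iff_ne_zero] using hi)] at h1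
    · exact absurd h1 (Nat.cast_add_one_ne_zero _)

/-- Derivations dual to a family of elements act on polynomials in these as partial derivatives. -/
theorem Derivation.map_aeval_eq_aeval_pderiv [DecidableEq ι] {φ : ι → K} {D : Derivation ℂ K K}
    {j : ι} (hD : ∀ i, D (φ i) = if i = j then 1 else 0) (P : MvPolynomial ι ℂ) :
    D (aeval φ P) = aeval φ (pderiv j P) := by
  induction P using MvPolynomial.induction_on with
  | C a => simp
  | add p q hp hq => simp [hp, hq]
  | mul_X p i hp => simp [hp, hD, Pi.single_apply, pderiv_X, apply_ite (aeval φ), eq_comm]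

/-- Elements with a dual family of derivations are algebraically independent. -/
theorem aeval_injective_of_derivation_dual [DecidableEq ι] {φ : ι → K} {D : ι → Derivation ℂ K K}
    (hD : ∀ i j, D j (φ i) = if i = j then 1 else 0) :
    Function.Injective (aeval φ : MvPolynomial ι ℂ →ₐ[ℂ] K) := by
  rw [injective_iff_map_eq_zero]
  -- Induction on a degree bound: the partial derivatives of a relation are relations of smaller
  -- degree, hence zero. The bound is strict so that `N = 0` forces `P = 0`.
  suffices H : ∀ (N : ℕ) (P : MvPolynomial ι ℂ), (∀ s, coeff s P ≠ 0 → s.degree < N) →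
      aeval φ P = 0 → P = 0 from fun P hP ↦ H (P.totalDegree + 1) P
        (fun s hs ↦ Nat.lt_succ_of_le (le_totalDegree (mem_support_iff.mpr hs))) hP
  intro N
  induction N with
  | zero =>
    intro P hP _
    ext s
    by_contra hs
    exact absurd (hP s hs) (Nat.not_lt_zero _)
  | succ N ih =>
    intro P hP h0
    have h1 := MvPolynomial.eq_C_of_forall_pderiv_eq_zero fun i ↦ ih (pderiv i P) (fun s hs ↦ by
      rw [coeff_pderiv] at hs
      have := hP _ (left_ne_zero_of_mul hs)
      rw [map_add, Finsupp.degree_single] at this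
      omega) (by rw [← Derivation.map_aeval_eq_aeval_pderiv (hD · i), h0, map_zero])
    rw [h1, aeval_C, map_eq_zero] at h0
    rw [h1, h0, C_0]

end AlgebraicIndependence

/-! ### Transport to polynomial vector fields -/

section Conjugation

open MvPolynomial

variable {K : Type*} [Field K] [Algebra ℂ K] {n : ℕ}

/-- A Lie algebra of derivations acting faithfully on algebraically independent elements, which
together with the constants span an invariant space, is conjugate to a Lie algebra of polynomial
vector fields of degree at most one. -/
theorem exists_lieEquiv_of_invariant_span (g : LieSubalgebra ℂ (Derivation ℂ K K)) {φ : Fin n → K}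
    (hφ : Function.Injective (aeval φ : MvPolynomial (Fin n) ℂ →ₐ[ℂ] K))
    (hspan : ∀ v ∈ g, ∀ i, v (φ i) ∈ Submodule.span ℂ (insert 1 (Set.range φ)))
    (hfaith : ∀ v ∈ g, (∀ i, v (φ i) = 0) → v = 0) :
    ∃ a : LieSubalgebra ℂ
        (Derivation ℂ (MvPolynomial (Fin n) ℂ) (MvPolynomial (Fin n) ℂ)),
      (∀ D ∈ a, ∀ i, (D (X i)).totalDegree ≤ 1) ∧ ∃ e : g ≃ₗ⁅ℂ⁆ a, ∀ (v : g) P,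
        (v : Derivation ℂ K K) (aeval φ P) =
          aeval φ ((e v : Derivation ℂ (MvPolynomial (Fin n) ℂ) (MvPolynomial (Fin n) ℂ)) P) := by
  have key : ∀ f ∈ Submodule.span ℂ (insert 1 (Set.range φ)),
      ∃ Q : MvPolynomial (Fin n) ℂ, Q.totalDegree ≤ 1 ∧ aeval φ Q = f := by
    intro f hf
    induction hf using Submodule.span_induction with
    | mem x hx =>
      rcases hx with rfl | ⟨i, rfl⟩
      · exact ⟨1, by simp, by simp⟩
      · exact ⟨X i, by simp, by simp⟩
    | zero => exact ⟨0, by simp, by simp⟩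
    | add x y _ _ hx hy =>
      obtain ⟨p, hp, rfl⟩ := hx
      obtain ⟨q, hq, rfl⟩ := hy
      exact ⟨p + q, (totalDegree_add p q).trans (max_le hp hq), by simp⟩
    | smul c x _ hx =>
      obtain ⟨p, hp, rfl⟩ := hx
      exact ⟨c • p, (totalDegree_smul_le c p).trans hp, by simp⟩
  choose L hL1 hL2 using fun (v : g) (i : Fin n) ↦ key _ (hspan v v.2 i)
  have hrel : ∀ (v : g) P, (v : Derivation ℂ K K) (aeval φ P) =
      aeval φ (mkDerivation ℂ (L v) P) := by
    intro v P
    induction P using MvPolynomial.induction_on with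
    | C a => simp
    | add p q hp hq => simp [hp, hq]
    | mul_X p i hp => simp [hp, hL2]
  -- The polynomials `L v i` were chosen without any linearity; injectivity of `aeval φ` makes the
  -- lift of `v` unique, hence linear and compatible with brackets.
  let E : g →ₗ⁅ℂ⁆ Derivation ℂ (MvPolynomial (Fin n) ℂ) (MvPolynomial (Fin n) ℂ) :=
    { toFun := fun v ↦ mkDerivation ℂ (L v)
      map_add' := fun v w ↦ Derivation.ext fun P ↦ hφ (by
        rw [← hrel]; simp [hrel])
      map_smul' := fun c v ↦ Derivation.ext fun P ↦ hφ (by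
        rw [← hrel]; simp [hrel])
      map_lie' := fun {v w} ↦ Derivation.ext fun P ↦ hφ (by
        rw [← hrel]; simp [hrel, Derivation.commutator_apply]) }
  have hE : Function.Injective E := by
    rw [injective_iff_map_eq_zero]
    intro v hv
    refine Subtype.ext (hfaith v v.2 fun i ↦ ?_)
    rw [← aeval_X (R := ℂ) φ i, hrel]
    change aeval φ (E v (X i)) = 0
    simp [hv]
  refine ⟨E.range, ?_, LieEquiv.ofInjective E hE, fun v P ↦ ?_⟩
  · rintro _ ⟨v, rfl⟩ i
    change (mkDerivation ℂ (L v) (X i)).totalDegree ≤ 1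
    rw [mkDerivation_X]
    exact hL1 v i
  · rw [LieEquiv.ofInjective_apply]
    exact hrel v P

end Conjugation

/-! ### The span of the coordinates in a commuting frame -/

section CoordinateSpan

variable {K : Type*} [Field K] [Algebra ℂ K] {n : ℕ}

/-- The complex span of the coordinates, in a frame `B`, of the elements of `g`. -/
def coordinateSpan (g : LieSubalgebra ℂ (Derivation ℂ K K))
    (B : Module.Basis (Fin n) K (Derivation ℂ K K)) : Submodule ℂ K :=
  Submodule.span ℂ {f | ∃ w ∈ g, ∃ i, B.repr w i = f}

theorem Derivation.lie_smul_eq (D E : Derivation ℂ K K) (f : K) :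
    ⁅D, f • E⁆ = D f • E + f • ⁅D, E⁆ := by
  ext x
  simp [Derivation.commutator_apply]
  ring

variable {g : LieSubalgebra ℂ (Derivation ℂ K K)} {m : LieIdeal ℂ g}
  {b : Module.Basis (Fin n) ℂ m} {B : Module.Basis (Fin n) K (Derivation ℂ K K)}

theorem coordinate_mem_coordinateSpan {w : Derivation ℂ K K} (hw : w ∈ g) (i : Fin n) :
    B.repr w i ∈ coordinateSpan g B :=
  Submodule.subset_span ⟨w, hw, i, rfl⟩

theorem exists_sum_eq_of_mem (hB : ∀ i, B i = ((b i : g) : Derivation ℂ K K)) {v : g} (hv : v ∈ m) :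
    (v : Derivation ℂ K K) = ∑ i, b.repr ⟨v, hv⟩ i • B i := by
  let L : m →ₗ[ℂ] Derivation ℂ K K := g.toSubmodule.subtype ∘ₗ m.toSubmodule.subtype
  refine (congrArg L (b.sum_repr ⟨v, hv⟩)).symm.trans ?_
  rw [map_sum]
  exact Finset.sum_congr rfl fun i _ ↦ by rw [map_smul, hB]; rfl

theorem repr_of_mem (hB : ∀ i, B i = ((b i : g) : Derivation ℂ K K)) {v : g} (hv : v ∈ m)
    (i : Fin n) :
    B.repr (v : Derivation ℂ K K) i = algebraMap ℂ K (b.repr ⟨v, hv⟩ i) := by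
  rw [exists_sum_eq_of_mem hB hv]
  have : ∀ j, b.repr ⟨v, hv⟩ j • B j = algebraMap ℂ K (b.repr ⟨v, hv⟩ j) • B j := fun j ↦ by
    rw [algebraMap_smul]
  simp_rw [this, B.repr_sum_self]

/-- As the frame commutes, `B j (B.repr w i)` is the `i`-th coordinate of `⁅B j, w⁆`. This bracket
lies in the ideal `m`, whose elements have constant coordinates. -/
theorem basis_apply_coordinate (hB : ∀ i, B i = ((b i : g) : Derivation ℂ K K))
    (hab : ∀ x ∈ m, ∀ y ∈ m, ⁅x, y⁆ = 0) {w : Derivation ℂ K K} (hw : w ∈ g) (i j : Fin n) :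
    ∃ c : ℂ, algebraMap ℂ K c = B j (B.repr w i) := by
  have hmem : ⁅(b j : g), (⟨w, hw⟩ : g)⁆ ∈ m := lie_mem_left ℂ g m _ _ (b j).2
  refine ⟨_, (repr_of_mem hB hmem i).symm.trans ?_⟩
  have hcomm : ∀ k, ⁅B j, B k⁆ = 0 := fun k ↦ by
    rw [hB, hB]
    exact congrArg Subtype.val (hab _ (b j).2 _ (b k).2)
  have h1 : ((⁅(b j : g), (⟨w, hw⟩ : g)⁆ : g) : Derivation ℂ K K) =
      ∑ k, B j (B.repr w k) • B k := by
    rw [LieSubalgebra.coe_bracket, ← hB]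
    change ⁅B j, w⁆ = _
    conv_lhs => rw [← B.sum_repr w]
    simp_rw [lie_sum, Derivation.lie_smul_eq, hcomm, smul_zero, add_zero]
  rw [h1, B.repr_sum_self]

theorem basis_apply_coordinateSpan (hB : ∀ i, B i = ((b i : g) : Derivation ℂ K K))
    (hab : ∀ x ∈ m, ∀ y ∈ m, ⁅x, y⁆ = 0) {f : K} (hf : f ∈ coordinateSpan g B) (j : Fin n) :
    ∃ c : ℂ, algebraMap ℂ K c = B j f := by
  induction hf using Submodule.span_induction with
  | mem x hx =>
    obtain ⟨w, hw, i, rfl⟩ := hx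
    exact basis_apply_coordinate hB hab hw i j
  | zero => exact ⟨0, by simp⟩
  | add x y _ _ hx hy =>
    obtain ⟨c, hc⟩ := hx
    obtain ⟨d, hd⟩ := hy
    exact ⟨c + d, by simp [hc, hd]⟩
  | smul a x _ hx =>
    obtain ⟨c, hc⟩ := hx
    exact ⟨a * c, by simp [hc, Algebra.smul_def]⟩

/-- In `v f = ∑ vⱼ Bⱼ(f)` the factors `Bⱼ(f)` are constants and the `vⱼ` are coordinates of an
element of `g`. -/
theorem apply_mem_coordinateSpan (hB : ∀ i, B i = ((b i : g) : Derivation ℂ K K))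
    (hab : ∀ x ∈ m, ∀ y ∈ m, ⁅x, y⁆ = 0) {v : Derivation ℂ K K} (hv : v ∈ g) {f : K}
    (hf : f ∈ coordinateSpan g B) : v f ∈ coordinateSpan g B := by
  rw [← B.sum_repr v, ← Derivation.coeFnAddMonoidHom_apply, map_sum, Finset.sum_apply]
  refine Submodule.sum_mem _ fun j _ ↦ ?_
  obtain ⟨c, hc⟩ := basis_apply_coordinateSpan hB hab hf j
  rw [Derivation.coeFnAddMonoidHom_apply, Derivation.smul_apply, ← hc, smul_eq_mul, mul_comm,
    ← Algebra.smul_def]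
  exact Submodule.smul_mem _ _ (coordinate_mem_coordinateSpan hv j)

theorem one_mem_coordinateSpan (hB : ∀ i, B i = ((b i : g) : Derivation ℂ K K)) (hn : 0 < n) :
    (1 : K) ∈ coordinateSpan g B := by
  have := coordinate_mem_coordinateSpan (g := g) (B := B) (w := B ⟨0, hn⟩)
    (by rw [hB]; exact (b ⟨0, hn⟩ : g).2) ⟨0, hn⟩
  simpa using this

/-- The elements of `m` annihilating the coordinate span form an ideal. -/
def coordinateAnnihilator (hB : ∀ i, B i = ((b i : g) : Derivation ℂ K K))
    (hab : ∀ x ∈ m, ∀ y ∈ m, ⁅x, y⁆ = 0) : LieIdeal ℂ g where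
  carrier := {v | v ∈ m ∧ ∀ f ∈ coordinateSpan g B, (v : Derivation ℂ K K) f = 0}
  add_mem' hv hw := ⟨add_mem hv.1 hw.1, fun f hf ↦ by simp [hv.2 f hf, hw.2 f hf]⟩
  zero_mem' := ⟨zero_mem _, fun f _ ↦ by simp⟩
  smul_mem' c v hv := ⟨m.smul_mem c hv.1, fun f hf ↦ by simp [hv.2 f hf]⟩
  lie_mem := by
    intro w v hv
    refine ⟨lie_mem_right ℂ g m w v hv.1, fun f hf ↦ ?_⟩
    rw [LieSubalgebra.coe_bracket, Derivation.commutator_apply, hv.2 f hf,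
      hv.2 _ (apply_mem_coordinateSpan hB hab w.2 hf)]
    simp

variable (hB : ∀ i, B i = ((b i : g) : Derivation ℂ K K))
  (hab : ∀ x ∈ m, ∀ y ∈ m, ⁅x, y⁆ = 0)
  (hirr : ∀ I : LieIdeal ℂ g, I ≤ m → I = ⊥ ∨ I = m) (hna : ¬ IsLieAbelian g)
  (hK : ∀ f : K, (∀ D : Derivation ℂ K K, D f = 0) → ∃ c, algebraMap ℂ K c = f)

include hK in
theorem exists_algebraMap_eq_of_forall_basis {f : K} (hf : ∀ j, B j f = 0) :
    ∃ c, algebraMap ℂ K c = f :=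
  hK f fun D ↦ by
    rw [← B.sum_repr D, ← Derivation.coeFnAddMonoidHom_apply, map_sum, Finset.sum_apply]
    exact Finset.sum_eq_zero fun j _ ↦ by simp [hf]

-- By irreducibility `coordinateAnnihilator` is zero or `m`. In the second case all coordinates of
-- elements of `g` are constant, so `g = m` would be abelian.
include hB hab hirr hna hK in
theorem eq_zero_of_forall_coordinateSpan {v : g} (hv : v ∈ m)
    (h : ∀ f ∈ coordinateSpan g B, (v : Derivation ℂ K K) f = 0) : v = 0 := by
  rcases hirr (coordinateAnnihilator hB hab) fun x hx ↦ hx.1 with hI | hI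
  · have : v ∈ coordinateAnnihilator hB hab := ⟨hv, h⟩
    rwa [hI, LieSubmodule.mem_bot] at this
  · refine absurd ?_ hna
    have hkill : ∀ f ∈ coordinateSpan g B, ∀ j, B j f = 0 := fun f hf j ↦ by
      have : (b j : g) ∈ coordinateAnnihilator hB hab := by rw [hI]; exact (b j).2
      rw [hB]
      exact this.2 f hf
    have htop : ∀ w : g, w ∈ m := fun w ↦ by
      choose c hc using fun i ↦ exists_algebraMap_eq_of_forall_basis hK
        (hkill _ (coordinate_mem_coordinateSpan w.2 i))
      have : w = ∑ i, c i • (b i : g) := Subtype.ext (by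
        rw [← B.sum_repr (w : Derivation ℂ K K)]
        simp [← hc, hB])
      rw [this]
      exact m.toSubmodule.sum_mem fun i _ ↦ m.smul_mem _ (b i).2
    exact ⟨fun x y ↦ hab x (htop x) y (htop y)⟩

include hB hab hirr hna hK in
/-- The coordinate span contains functions dual to the frame `B`. -/
theorem exists_dual_mem_coordinateSpan : ∃ φ : Fin n → K, (∀ i, φ i ∈ coordinateSpan g B) ∧
    ∀ i j, B j (φ i) = if i = j then 1 else 0 := by
  -- `W` is the space of gradients `(Bⱼ f)ⱼ` of elements of the coordinate span. A functional
  -- vanishing on `W`, with coefficients `aⱼ`, amounts to an element `∑ aⱼ bⱼ` of `m` killing that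
  -- span, which must be zero.
  let W : Submodule ℂ (Fin n → ℂ) :=
    { carrier := {c | ∃ f ∈ coordinateSpan g B, ∀ j, B j f = algebraMap ℂ K (c j)}
      add_mem' := by
        rintro c d ⟨f, hf, hc⟩ ⟨f', hf', hd⟩
        exact ⟨f + f', add_mem hf hf', fun j ↦ by simp [hc, hd]⟩
      zero_mem' := ⟨0, zero_mem _, by simp⟩
      smul_mem' := by
        rintro a c ⟨f, hf, hc⟩
        exact ⟨a • f, Submodule.smul_mem _ a hf, fun j ↦ by simp [hc, Algebra.smul_def]⟩ }
  have hW : W = ⊤ := by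
    by_contra hne
    obtain ⟨l, hl, hle⟩ := W.exists_le_ker_of_lt_top (lt_top_iff_ne_top.mpr hne)
    refine hl (LinearMap.pi_ext' fun j ↦ LinearMap.ext_ring ?_)
    let a : Fin n → ℂ := fun j ↦ l (Pi.single j 1)
    have hla : ∀ c, l c = ∑ j, c j * a j := fun c ↦ by
      conv_lhs => rw [← Finset.univ_sum_single c]
      rw [map_sum]
      refine Finset.sum_congr rfl fun j _ ↦ ?_
      rw [← smul_eq_mul, ← map_smul, ← Pi.single_smul, smul_eq_mul, mul_one]
    have h0 : ∑ j, a j • (b j : g) = 0 := by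
      refine eq_zero_of_forall_coordinateSpan hB hab hirr hna hK
        (m.toSubmodule.sum_mem fun i _ ↦ m.smul_mem _ (b i).2) fun f hf ↦ ?_
      choose c hc using basis_apply_coordinateSpan hB hab hf
      have h1 : l c = 0 := hle ⟨f, hf, fun j ↦ (hc j).symm⟩
      have h2 := congrArg (algebraMap ℂ K) ((hla c).symm.trans h1)
      rw [map_zero, map_sum] at h2
      rw [← h2]
      have : ((∑ j, a j • (b j : g) : g) : Derivation ℂ K K) = ∑ j, a j • B j := by
        simp [hB]
      rw [this, ← Derivation.coeFnAddMonoidHom_apply, map_sum, Finset.sum_apply]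
      refine Finset.sum_congr rfl fun j _ ↦ ?_
      simp [← hc, Algebra.smul_def, mul_comm]
    have h0' : ∑ j, a j • b j = 0 := Subtype.ext (by simpa using h0)
    simpa using Fintype.linearIndependent_iff.mp b.linearIndependent a h0' j
  have hmem : ∀ i, Pi.single i 1 ∈ W := fun i ↦ hW ▸ Submodule.mem_top
  choose φ hφ hφ' using hmem
  refine ⟨φ, hφ, fun i j ↦ ?_⟩
  rw [hφ']
  simp [Pi.single_apply, eq_comm, apply_ite (algebraMap ℂ K)]

-- The difference `f - ∑ Bᵢ(f) φᵢ` is killed by the frame, hence constant.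
include hB hab hK in
theorem coordinateSpan_eq_span (hn : 0 < n) {φ : Fin n → K} (hφ : ∀ i, φ i ∈ coordinateSpan g B)
    (hdual : ∀ i j, B j (φ i) = if i = j then 1 else 0) :
    coordinateSpan g B = Submodule.span ℂ (insert 1 (Set.range φ)) := by
  refine le_antisymm (fun f hf ↦ ?_) (Submodule.span_le.mpr ?_)
  · choose c hc using basis_apply_coordinateSpan hB hab hf
    obtain ⟨d, hd⟩ := exists_algebraMap_eq_of_forall_basis (B := B) hK
      (f := f - ∑ i, c i • φ i) fun j ↦ by simp [hdual, ← hc, Algebra.smul_def]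
    rw [sub_eq_iff_eq_add.mp hd.symm, Algebra.algebraMap_eq_smul_one]
    exact add_mem (Submodule.smul_mem _ _ (Submodule.subset_span (Set.mem_insert _ _)))
      (Submodule.sum_mem _ fun i _ ↦ Submodule.smul_mem _ _
        (Submodule.subset_span (Set.mem_insert_of_mem _ ⟨i, rfl⟩)))
  · rintro _ (rfl | ⟨i, rfl⟩)
    · exact one_mem_coordinateSpan hB hn
    · exact hφ i

theorem finrank_span_insert_one {φ : Fin n → K}
    (hdual : ∀ i j, B j (φ i) = if i = j then 1 else 0) :
    Module.finrank ℂ (Submodule.span ℂ (insert 1 (Set.range φ))) = n + 1 := by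
  have hli : LinearIndependent ℂ (Fin.cons 1 φ : Fin (n + 1) → K) := by
    rw [Fintype.linearIndependent_iff]
    intro c hc
    rw [Fin.sum_univ_succ] at hc
    simp only [Fin.cons_zero, Fin.cons_succ] at hc
    have h1 : ∀ j : Fin n, c j.succ = 0 := fun j ↦ by
      have := congrArg (B j) hc
      simpa [hdual] using this
    intro i
    refine Fin.cases ?_ h1 i
    simpa [h1] using hc
  have := finrank_span_eq_card hli
  rwa [Fin.range_cons, Fintype.card_fin] at this

end CoordinateSpan

/-! ### Top exterior powers, determinants and Cramer's rule -/

section Wedge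

variable {K E : Type*} [Field K] [AddCommGroup E] [Module K E]

theorem ExteriorAlgebra.ιMulti_mul_ι {k : ℕ} (u : Fin k → E) (w : E) :
    ExteriorAlgebra.ιMulti K k u * ExteriorAlgebra.ι K w =
      ExteriorAlgebra.ιMulti K (k + 1) (Fin.snoc u w) := by
  rw [ExteriorAlgebra.ιMulti_apply, ExteriorAlgebra.ιMulti_apply, List.ofFn_succ']
  simp

theorem ExteriorAlgebra.ιMulti_eq_det_smul {k : ℕ} (B : Module.Basis (Fin k) K E) (v : Fin k → E) :
    ExteriorAlgebra.ιMulti K k v = B.det v • ExteriorAlgebra.ιMulti K k B := by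
  have : ExteriorAlgebra.ιMulti K k =
      (LinearMap.toSpanSingleton K _ (ExteriorAlgebra.ιMulti K k B)).compAlternatingMap B.det := by
    refine B.ext_alternating fun σ hσ ↦ ?_
    let τ := Equiv.ofBijective σ (Finite.injective_iff_bijective.mp hσ)
    change ExteriorAlgebra.ιMulti K k (B ∘ τ) =
      LinearMap.toSpanSingleton K _ (ExteriorAlgebra.ιMulti K k B) (B.det (B ∘ τ))
    rw [AlternatingMap.map_perm, AlternatingMap.map_perm, B.det_self]
    simp
  exact congrArg (fun f ↦ f v) this

/-- The determinant extends to a linear functional on the exterior algebra that takes the value `1`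
on this wedge. -/
theorem ExteriorAlgebra.ιMulti_basis_ne_zero {k : ℕ} (B : Module.Basis (Fin k) K E) :
    ExteriorAlgebra.ιMulti K k B ≠ 0 := by
  intro h
  have := congrArg (ExteriorAlgebra.liftAlternating (R := K) (M := E) (N := K)
    (fun i ↦ if hi : i = k then hi ▸ B.det else 0)) h
  rw [ExteriorAlgebra.liftAlternating_apply_ιMulti] at this
  have h1 := congrArg (fun f : AlternatingMap K E K (Fin k) ↦ f B)
    (show B.det = 0 by simpa using this)
  simp [B.det_self] at h1

theorem ExteriorAlgebra.ιMulti_mul_ι_eq_smul_iff {k : ℕ} (B : Module.Basis (Fin (k + 1)) K E)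
    (u : Fin k → E) (w : E) (f : K) :
    ExteriorAlgebra.ιMulti K k u * ExteriorAlgebra.ι K w =
      f • ExteriorAlgebra.ιMulti K (k + 1) B ↔ B.det (Fin.snoc u w) = f := by
  rw [ExteriorAlgebra.ιMulti_mul_ι, ExteriorAlgebra.ιMulti_eq_det_smul B]
  exact smul_left_inj (ExteriorAlgebra.ιMulti_basis_ne_zero B)

theorem Module.Basis.det_snoc_eq_sum {k : ℕ} (B : Module.Basis (Fin (k + 1)) K E)
    (u : Fin k → E) (w : E) :
    B.det (Fin.snoc u w) = ∑ i, B.repr w i * B.det (Fin.snoc u (B i)) := by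
  have h : ∀ x, (Fin.snoc u x : Fin (k + 1) → E) =
      Function.update (Fin.snoc u w) (Fin.last k) x := fun x ↦ by rw [Fin.update_snoc_last]
  conv_lhs => rw [h, ← B.sum_repr w]
  rw [AlternatingMap.map_update_sum]
  refine Finset.sum_congr rfl fun i _ ↦ ?_
  rw [AlternatingMap.map_update_smul, B.sum_repr, ← h, smul_eq_mul]

/-- Cramer's rule up to sign: with every basis vector but the `j`-th in the first slots, only the
`j`-th component of `w` contributes. -/
theorem Module.Basis.det_snoc_succAbove {k : ℕ} (B : Module.Basis (Fin (k + 1)) K E)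
    (j : Fin (k + 1)) (w : E) :
    ∃ s : ℤˣ, B.det (Fin.snoc (B ∘ j.succAbove) w) = (s : ℤ) • B.repr w j := by
  have hinj : Function.Injective (Fin.snoc j.succAbove j : Fin (k + 1) → Fin (k + 1)) :=
    Fin.snoc_injective_iff.mpr ⟨Fin.succAbove_right_injective, by simp⟩
  let τ := Equiv.ofBijective _ (Finite.injective_iff_bijective.mp hinj)
  have hτ : (Fin.snoc (B ∘ j.succAbove) (B j) : Fin (k + 1) → E) = B ∘ τ :=
    (Fin.comp_snoc B j.succAbove j).symm
  refine ⟨Equiv.Perm.sign τ, ?_⟩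
  rw [B.det_snoc_eq_sum, Finset.sum_eq_single j, hτ, AlternatingMap.map_perm, B.det_self]
  · rw [Units.smul_def, mul_smul_comm, mul_one]
  · intro i _ hij
    obtain ⟨l, rfl⟩ := Fin.exists_succAbove_eq hij
    rw [AlternatingMap.map_eq_zero_of_eq _ _ (i := l.castSucc) (j := Fin.last k) (by simp)
      (Fin.castSucc_lt_last l).ne, mul_zero]
  · simp

end Wedge

theorem wedgeQuotients_eq_coordinateSpan {X : Scheme.{0}} [IsIntegral X] [X.Over SpecC] {n : ℕ}
    (hn : 0 < n) (g : LieSubalgebra ℂ (RatVectorField X)) {m : LieIdeal ℂ g}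
    (b : Module.Basis (Fin n) ℂ m)
    (B : Module.Basis (Fin n) (RatFun X) (RatVectorField X))
    (hB : ∀ i, B i = ((b i : g) : RatVectorField X)) :
    wedgeQuotients g b = coordinateSpan g B := by
  -- With `n = k + 1` the truncated `n - 1` of `wedgeQuotients` reduces to `k`.
  obtain ⟨k, rfl⟩ := Nat.exists_eq_succ_of_ne_zero hn.ne'
  have hB' : (fun i ↦ ((b i : g) : RatVectorField X)) = B := funext fun i ↦ (hB i).symm
  refine le_antisymm (Submodule.span_le.mpr ?_) (Submodule.span_le.mpr ?_)
  · rintro f ⟨(u : Fin k → m), w, h⟩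
    rw [hB'] at h
    have hdet : B.det (Fin.snoc (fun i ↦ ((u i : g) : RatVectorField X))
        (w : RatVectorField X)) = f := (ExteriorAlgebra.ιMulti_mul_ι_eq_smul_iff B _ _ f).mp h
    rw [← hdet, B.det_snoc_eq_sum]
    refine Submodule.sum_mem _ fun i _ ↦ ?_
    -- All columns of this determinant come from `m`, so its entries are constants.
    have hc : ∃ c : ℂ, algebraMap ℂ (RatFun X) c =
        B.det (Fin.snoc (fun i ↦ ((u i : g) : RatVectorField X)) (B i)) := by
      have hcoef : ∀ x : m, ∀ l, B.repr ((x : g) : RatVectorField X) l =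
          algebraMap ℂ _ (b.repr x l) := fun x l ↦ repr_of_mem hB x.2 l
      refine ⟨b.det (Fin.snoc (α := fun _ ↦ m) u (b i)), ?_⟩
      rw [Module.Basis.det_apply, Module.Basis.det_apply, RingHom.map_det]
      congr 1
      ext r s
      refine Fin.lastCases ?_ (fun s ↦ ?_) s
      · simp [Module.Basis.toMatrix_apply, hB, hcoef]
      · simp [Module.Basis.toMatrix_apply, hcoef]
    obtain ⟨c, hc⟩ := hc
    rw [← hc, mul_comm, ← Algebra.smul_def]
    exact Submodule.smul_mem _ _ (coordinate_mem_coordinateSpan w.2 i)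
  · rintro _ ⟨w, hw, j, rfl⟩
    obtain ⟨s, hs⟩ := B.det_snoc_succAbove j w
    have hmem : B.det (Fin.snoc (B ∘ j.succAbove) w) ∈ wedgeQuotients g b := by
      refine Submodule.subset_span ⟨fun i ↦ b (j.succAbove i), ⟨w, hw⟩, ?_⟩
      rw [hB']
      refine (ExteriorAlgebra.ιMulti_mul_ι_eq_smul_iff B _ _ _).mpr ?_
      congr 2
      exact funext fun i ↦ (hB _).symm
    have := zsmul_mem hmem (s : ℤ)
    rwa [hs, smul_smul, ← Units.val_mul, Int.units_mul_self, Units.val_one, one_smul] at this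

/-! ### Minimality and uniqueness of the abelian ideal -/

section AffineDecomposition

variable {L : Type*} [LieRing L] [LieAlgebra ℂ L]

theorem RatVF.IsAffineDecomposition.eq_bot_or_eq {h : LieSubalgebra ℂ L} {m : LieIdeal ℂ L}
    (H : IsAffineDecomposition h m) {I : LieIdeal ℂ L} (hI : I ≤ m) : I = ⊥ ∨ I = m := by
  let N : LieSubmodule ℂ h m :=
    { carrier := {x | (x : L) ∈ I}
      add_mem' := fun {x y} hx hy ↦ (add_mem hx hy : (x : L) + y ∈ I)
      zero_mem' := zero_mem I
      smul_mem' := fun c _ hx ↦ I.smul_mem c hx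
      lie_mem := fun {x y} hy ↦ lie_mem_right ℂ L I (x : L) (y : L) hy }
  have := H.irreducible
  rcases eq_bot_or_eq_top N with hN | hN
  · refine Or.inl ((LieSubmodule.eq_bot_iff I).mpr fun x hx ↦ ?_)
    have : (⟨x, hI hx⟩ : m) ∈ N := hx
    rw [hN, LieSubmodule.mem_bot] at this
    exact congrArg Subtype.val this
  · refine Or.inr (le_antisymm hI fun x hx ↦ ?_)
    have : (⟨x, hx⟩ : m) ∈ N := hN ▸ LieSubmodule.mem_top _
    exact this

/-- Write `x = a + u` with `a ∈ h` and `u ∈ m`. As `m` is abelian, `a` centralizes `m` too, so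
faithfulness gives `a = 0`. -/
theorem RatVF.IsAffineDecomposition.mem_of_forall_lie_eq_zero {h : LieSubalgebra ℂ L}
    {m : LieIdeal ℂ L} (H : IsAffineDecomposition h m) {x : L} (hx : ∀ y ∈ m, ⁅x, y⁆ = 0) :
    x ∈ m := by
  obtain ⟨a, ha, u, hu, rfl⟩ := Submodule.mem_sup.mp
    (H.isCompl.sup_eq_top ▸ Submodule.mem_top : x ∈ h.toSubmodule ⊔ m.toSubmodule)
  have : a = 0 := H.faithful a ha fun y hy ↦ by
    simpa [H.abelian u hu y hy] using hx y hy
  rw [this, zero_add]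
  exact hu

theorem RatVF.IsAffineDecomposition.ne_bot {h : LieSubalgebra ℂ L} {m : LieIdeal ℂ L}
    (H : IsAffineDecomposition h m) : m ≠ ⊥ := by
  rintro rfl
  have := H.irreducible
  refine bot_ne_top (α := LieSubmodule ℂ h (⊥ : LieIdeal ℂ L)) ?_
  ext x
  simpa using Subsingleton.elim x 0

/-- The abelian ideal of a decomposition of affine type is unique. -/
theorem RatVF.IsAffineDecomposition.ideal_unique {h h' : LieSubalgebra ℂ L} {m m' : LieIdeal ℂ L}
    (H : IsAffineDecomposition h m) (H' : IsAffineDecomposition h' m') : m = m' := by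
  -- If `m ⊓ m' = ⊥`, then `⁅m', m⁆ ≤ m ⊓ m'` vanishes, so `m'` lies in the centralizer of `m`,
  -- which is `m`, and is therefore zero.
  rcases H.eq_bot_or_eq (inf_le_left : m ⊓ m' ≤ m) with hI | hI
  · refine absurd (le_bot_iff.mp fun x hx ↦ ?_) H'.ne_bot
    rw [← hI]
    refine ⟨H.mem_of_forall_lie_eq_zero fun y hy ↦ ?_, hx⟩
    have : ⁅x, y⁆ ∈ m ⊓ m' := ⟨lie_mem_right ℂ L m x y hy, lie_mem_left ℂ L m' x y hx⟩
    rwa [hI, LieSubmodule.mem_bot] at this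
  · rcases H'.eq_bot_or_eq (inf_le_right : m ⊓ m' ≤ m') with hJ | hJ
    · exact absurd (hI.symm.trans hJ) H.ne_bot
    · exact hI.symm.trans hJ

end AffineDecomposition

/-! ### General points and their local rings -/

section GeneralPoint

variable {X : Scheme.{0}}

theorem RatVF.ForGeneralPoint.mono {P Q : X → Prop} (hP : ForGeneralPoint P)
    (h : ∀ p, IsClosed ({p} : Set X) → P p → Q p) : ForGeneralPoint Q := by
  obtain ⟨U, hU, H⟩ := hP
  exact ⟨U, hU, fun p hp hc ↦ h p hc (H p hp hc)⟩

/-- Closed points are dense in a scheme locally of finite type over `ℂ`, so a statement about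
general points is not vacuous. -/
theorem RatVF.ForGeneralPoint.exists_isClosed [X.Over SpecC] [LocallyOfFiniteType (X ↘ SpecC)]
    {P : X → Prop} (hP : ForGeneralPoint P) : ∃ p : X, IsClosed ({p} : Set X) ∧ P p := by
  obtain ⟨U, hU, H⟩ := hP
  have : JacobsonSpace X := LocallyOfFiniteType.jacobsonSpace (X ↘ SpecC)
  obtain ⟨p, hp, hc⟩ := nonempty_inter_closedPoints hU U.2.isLocallyClosed
  exact ⟨p, hc, H p hp hc⟩

variable [IsIntegral X]

theorem RatVF.forGeneralPoint_of_forall {P : X → Prop} (h : ∀ p, P p) : ForGeneralPoint P :=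
  ⟨⊤, ⟨genericPoint X, trivial⟩, fun p _ _ ↦ h p⟩

theorem RatVF.ForGeneralPoint.and {P Q : X → Prop} (hP : ForGeneralPoint P)
    (hQ : ForGeneralPoint Q) : ForGeneralPoint fun p ↦ P p ∧ Q p := by
  obtain ⟨U, hU, H⟩ := hP
  obtain ⟨V, hV, H'⟩ := hQ
  refine ⟨U ⊓ V, nonempty_preirreducible_inter U.2 V.2 hU hV,
    fun p hp hc ↦ ⟨H p hp.1 hc, H' p hp.2 hc⟩⟩

theorem RatVF.ForGeneralPoint.all {ι : Type*} (s : Finset ι) {P : ι → X → Prop}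
    (h : ∀ i ∈ s, ForGeneralPoint (P i)) : ForGeneralPoint fun p ↦ ∀ i ∈ s, P i p := by
  classical
  induction s using Finset.induction_on with
  | empty => exact forGeneralPoint_of_forall (by simp)
  | insert a s ha ih =>
    refine ((h a (by simp)).and (ih fun i hi ↦ h i (by simp [hi]))).mono fun p _ hp i hi ↦ ?_
    rcases Finset.mem_insert.mp hi with rfl | hi
    · exact hp.1
    · exact hp.2 i hi

/-- A rational function is regular at a general point. -/
theorem RatVF.forGeneralPoint_mem_range (f : RatFun X) :
    ForGeneralPoint fun p : X ↦ f ∈ (algebraMap (X.presheaf.stalk p) (RatFun X)).range := by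
  obtain ⟨U, hU, s, hs⟩ := X.presheaf.exists_germ_eq f
  have : Nonempty U := ⟨⟨_, hU⟩⟩
  refine ⟨U, ⟨_, hU⟩, fun p hp _ ↦ ⟨X.presheaf.germ U p hp s, ?_⟩⟩
  rw [Scheme.algebraMap_germ_eq_germToFunctionField]
  exact hs

variable [X.Over SpecC]

/-- The inclusion of the constants in the local ring of a point. -/
noncomputable def RatVF.stalkConstants (p : X) : ℂ →+* X.presheaf.stalk p :=
  ((Scheme.ΓSpecIso (CommRingCat.of ℂ)).inv ≫ (X ↘ SpecC).appTop ≫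
    X.presheaf.germ ⊤ p trivial).hom

theorem RatVF.algebraMap_stalkConstants (p : X) (c : ℂ) :
    algebraMap (X.presheaf.stalk p) (RatFun X) (stalkConstants p c) = algebraMap ℂ (RatFun X) c := by
  have : Nonempty (⊤ : X.Opens) := ⟨⟨p, trivial⟩⟩
  exact Scheme.algebraMap_germ_eq_germToFunctionField X (U := ⊤) trivial _

omit [IsIntegral X] in
theorem RatVF.fromSpecStalk_over (p : X) :
    X.fromSpecStalk p ≫ (X ↘ SpecC) = Spec.map (CommRingCat.ofHom (stalkConstants p)) := by
  have h : (X ↘ SpecC) = X.toSpecΓ ≫ Spec.map (X ↘ SpecC).appTop ≫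
      Spec.map (Scheme.ΓSpecIso (CommRingCat.of ℂ)).inv := by
    rw [← Scheme.toSpecΓ_naturality_assoc, ← SpecMap_ΓSpecIso_hom, ← Spec.map_comp]
    simp
  conv_lhs => rw [h]
  rw [Scheme.fromSpecStalk_toSpecΓ_assoc, ← Spec.map_comp, ← Spec.map_comp]
  simp [stalkConstants]

omit [IsIntegral X] in
/-- The residue field of a closed point is `ℂ`. -/
theorem RatVF.exists_sub_mem_maximalIdeal [LocallyOfFiniteType (X ↘ SpecC)] {p : X}
    (hp : IsClosed ({p} : Set X)) (s : X.presheaf.stalk p) :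
    ∃ c, s - stalkConstants p c ∈ IsLocalRing.maximalIdeal (X.presheaf.stalk p) := by
  let e := residueFieldIsoBase (X ↘ SpecC) p hp
  have he : CommRingCat.ofHom (stalkConstants p) ≫ X.residue p = e.inv := by
    apply Spec.map_injective
    rw [SpecMap_residueFieldIsoBase_inv, Spec.map_comp, ← fromSpecStalk_over]
    rfl
  let c : ℂ := e.hom (X.residue p s)
  have hc : X.residue p (stalkConstants p c) = X.residue p s := by
    change (CommRingCat.ofHom (stalkConstants p) ≫ X.residue p) c = _
    rw [he]
    exact e.hom_inv_id_apply _
  refine ⟨c, (IsLocalRing.residue_eq_zero_iff _).mp ?_⟩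
  change X.residue p (s - stalkConstants p c) = 0
  rw [map_sub, hc, sub_self]

end GeneralPoint

/-! ### Affine charts and regularity of vector fields -/

section Chart

variable {X : Scheme.{0}} [IsIntegral X] [X.Over SpecC]

/-- Sections over an open subset of a complex scheme form a `ℂ`-algebra. -/
noncomputable abbrev RatVF.sectionAlgebra (X : Scheme.{0}) [X.Over SpecC] (U : X.Opens) :
    Algebra ℂ Γ(X, U) :=
  ((Scheme.ΓSpecIso (CommRingCat.of ℂ)).inv ≫ (X ↘ SpecC).appLE ⊤ U le_top).hom.toAlgebra

theorem RatVF.germToFunctionField_algebraMap (U : X.Opens) [Nonempty U] (c : ℂ) :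
    X.germToFunctionField U
      (((Scheme.ΓSpecIso (CommRingCat.of ℂ)).inv ≫ (X ↘ SpecC).appLE ⊤ U le_top).hom c) =
      algebraMap ℂ (RatFun X) c := by
  have h : (X ↘ SpecC).appLE ⊤ U le_top ≫ X.germToFunctionField U =
      (X ↘ SpecC).appTop ≫ X.presheaf.germ ⊤ (genericPoint X) trivial := by
    change ((X ↘ SpecC).appTop ≫ X.presheaf.map (homOfLE le_top).op) ≫ _ = _
    rw [Category.assoc]
    exact congrArg _ (X.presheaf.germ_res _ _ _)
  exact congrArg (fun f ↦ f.hom ((Scheme.ΓSpecIso (CommRingCat.of ℂ)).inv.hom c)) h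

/-- A smooth variety has a non-empty affine chart which is standard smooth. -/
theorem RatVF.exists_isStandardSmooth_chart (n : ℕ) (X : Scheme.{0}) [IsIntegral X] [X.Over SpecC]
    [SmoothOfRelativeDimension n (X ↘ SpecC)] : ∃ (U : X.Opens), IsAffineOpen U ∧ Nonempty U ∧
      ((Scheme.ΓSpecIso (CommRingCat.of ℂ)).inv ≫
        (X ↘ SpecC).appLE ⊤ U le_top).hom.IsStandardSmoothOfRelativeDimension n := by
  obtain ⟨U₀, hU₀, U, hU, hx, e, h⟩ :=
    SmoothOfRelativeDimension.exists_isStandardSmoothOfRelativeDimension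
      (n := n) (f := X ↘ SpecC) (genericPoint X)
  have htop : U₀ = ⊤ := by
    have : Subsingleton SpecC := inferInstanceAs (Subsingleton (PrimeSpectrum ℂ))
    ext y
    simpa using (Subsingleton.elim ((X ↘ SpecC) (genericPoint X)) y) ▸ e hx
  subst htop
  refine ⟨U, hU, ⟨⟨_, hx⟩⟩, ?_⟩
  rw [CommRingCat.hom_comp]
  exact RingHom.isStandardSmoothOfRelativeDimension_respectsIso.2 _
    (Scheme.ΓSpecIso (CommRingCat.of ℂ)).symm.commRingCatIsoToRingEquiv h

/-- The function field is the fraction field of a standard smooth chart, whose module of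
differentials has rank `n`. -/
theorem RatVF.finrank_ratVectorField (n : ℕ) (X : Scheme.{0}) [IsIntegral X] [X.Over SpecC]
    [SmoothOfRelativeDimension n (X ↘ SpecC)] :
    Module.finrank (RatFun X) (RatVectorField X) = n ∧
      Module.Finite (RatFun X) (RatVectorField X) ∧ Algebra.EssFiniteType ℂ (RatFun X) := by
  obtain ⟨U, hU, hne, h⟩ := exists_isStandardSmooth_chart n X
  let : Algebra ℂ Γ(X, U) := sectionAlgebra X U
  have : Algebra.IsStandardSmoothOfRelativeDimension n ℂ Γ(X, U) := h
  have : IsScalarTower ℂ Γ(X, U) (RatFun X) :=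
    .of_algebraMap_eq fun c ↦ (germToFunctionField_algebraMap U c).symm
  have : IsFractionRing Γ(X, U) (RatFun X) := functionField_isFractionRing_of_isAffineOpen X U hU
  obtain ⟨h1, h2⟩ := finrank_derivation_of_isStandardSmooth (A := Γ(X, U)) (K := RatFun X) n
  have : Algebra.IsStandardSmooth ℂ Γ(X, U) :=
    Algebra.IsStandardSmoothOfRelativeDimension.isStandardSmooth n
  have : Algebra.EssFiniteType Γ(X, U) (RatFun X) := .of_isLocalization _ (nonZeroDivisors Γ(X, U))
  exact ⟨h1, h2, .comp ℂ Γ(X, U) (RatFun X)⟩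

/-- A rational vector field preserves the local ring of a general point. -/
theorem RatVF.forGeneralPoint_apply_mem_range [LocallyOfFiniteType (X ↘ SpecC)]
    (D : RatVectorField X) : ForGeneralPoint fun p : X ↦ ∀ s : X.presheaf.stalk p,
      D (algebraMap _ (RatFun X) s) ∈ (algebraMap (X.presheaf.stalk p) (RatFun X)).range := by
  obtain ⟨U, hU, hxU⟩ : ∃ U : X.Opens, IsAffineOpen U ∧ genericPoint X ∈ U := by
    obtain ⟨_, ⟨U, hU, rfl⟩, hxU, -⟩ := X.isBasis_affineOpens.exists_subset_of_mem_open
      (Set.mem_univ (genericPoint X)) isOpen_univ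
    exact ⟨U, hU, hxU⟩
  have : Nonempty U := ⟨⟨_, hxU⟩⟩
  let : Algebra ℂ Γ(X, U) := sectionAlgebra X U
  have : IsScalarTower ℂ Γ(X, U) (RatFun X) :=
    .of_algebraMap_eq fun c ↦ (germToFunctionField_algebraMap U c).symm
  have hft : Algebra.FiniteType ℂ Γ(X, U) := by
    have h := (X ↘ SpecC).finiteType_appLE (isAffineOpen_top SpecC) hU le_top
    exact RingHom.finiteType_respectsIso.2 _
      (Scheme.ΓSpecIso (CommRingCat.of ℂ)).symm.commRingCatIsoToRingEquiv h
  obtain ⟨t, ht⟩ := hft.out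
  have hU' : ForGeneralPoint fun p : X ↦ p ∈ U := ⟨U, ⟨_, hxU⟩, fun p hp _ ↦ hp⟩
  -- Regularity at `p` of `D` on the finitely many generators suffices: the Leibniz rule extends it
  -- to the chart, the quotient rule to the local ring.
  refine (hU'.and (ForGeneralPoint.all t (P := fun a p ↦ D (algebraMap _ (RatFun X) a) ∈
    (algebraMap (X.presheaf.stalk p) (RatFun X)).range) fun a _ ↦
      forGeneralPoint_mem_range _)).mono fun p _ ↦ ?_
  rintro ⟨hpU, hp⟩ s
  have hgerm : ∀ a : Γ(X, U), algebraMap Γ(X, U) (RatFun X) a ∈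
      (algebraMap (X.presheaf.stalk p) (RatFun X)).range := fun a ↦
    ⟨X.presheaf.germ U p hpU a, Scheme.algebraMap_germ_eq_germToFunctionField X hpU a⟩
  have hsec : ∀ a : Γ(X, U), D (algebraMap Γ(X, U) (RatFun X) a) ∈
      (algebraMap (X.presheaf.stalk p) (RatFun X)).range := fun a ↦ by
    have ha : a ∈ Algebra.adjoin ℂ (t : Set Γ(X, U)) := ht ▸ Algebra.mem_top
    induction ha using Algebra.adjoin_induction with
    | mem x hx => exact hp x hx
    | algebraMap c =>
      rw [← IsScalarTower.algebraMap_apply, Derivation.map_algebraMap]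
      exact zero_mem _
    | add x y _ _ hx hy =>
      rw [map_add, map_add]
      exact add_mem hx hy
    | mul x y _ _ hx hy =>
      rw [map_mul, Derivation.leibniz]
      exact add_mem (mul_mem (hgerm x) hy) (mul_mem (hgerm y) hx)
  let : Algebra Γ(X, U) (X.presheaf.stalk p) :=
    TopCat.Presheaf.algebra_section_stalk X.presheaf ⟨p, hpU⟩
  have : IsScalarTower Γ(X, U) (X.presheaf.stalk p) (RatFun X) :=
    functionField_isScalarTower X U ⟨p, hpU⟩
  have : IsLocalization.AtPrime (X.presheaf.stalk p) (hU.primeIdealOf ⟨p, hpU⟩).asIdeal :=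
    hU.isLocalization_stalk ⟨p, hpU⟩
  obtain ⟨⟨a, d⟩, hs⟩ := IsLocalization.surj (hU.primeIdealOf ⟨p, hpU⟩).asIdeal.primeCompl s
  obtain ⟨d', hd'⟩ := (IsLocalization.map_units (X.presheaf.stalk p) d).exists_right_inv
  have h1 := congrArg (algebraMap (X.presheaf.stalk p) (RatFun X)) hs
  have h2 := congrArg (algebraMap (X.presheaf.stalk p) (RatFun X)) hd'
  simp only [map_mul, ← IsScalarTower.algebraMap_apply, map_one] at h1 h2
  have h3 := congrArg D h1
  rw [Derivation.leibniz] at h3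
  have h4 : D (algebraMap _ (RatFun X) s) = algebraMap _ (RatFun X) d' *
      (D (algebraMap Γ(X, U) (RatFun X) a) - algebraMap _ (RatFun X) s *
        D (algebraMap Γ(X, U) (RatFun X) d)) := by
    simp only [smul_eq_mul] at h3
    linear_combination (-D (algebraMap _ (RatFun X) s)) * h2 + algebraMap _ (RatFun X) d' * h3
  rw [h4]
  exact mul_mem ⟨d', rfl⟩ (sub_mem (hsec a) (mul_mem ⟨s, rfl⟩ (hsec d)))

/-- A finite-dimensional Lie algebra of rational vector fields preserves the local ring of a
general point. -/
theorem RatVF.forGeneralPoint_forall_apply_mem_range [LocallyOfFiniteType (X ↘ SpecC)]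
    (g : LieSubalgebra ℂ (RatVectorField X)) [FiniteDimensional ℂ g] :
    ForGeneralPoint fun p : X ↦ ∀ v ∈ g, ∀ s : X.presheaf.stalk p,
      v (algebraMap _ (RatFun X) s) ∈ (algebraMap (X.presheaf.stalk p) (RatFun X)).range := by
  obtain ⟨t, ht⟩ := (Submodule.fg_top g.toSubmodule).mp (Module.Finite.fg_top (R := ℂ) (M := g))
  refine (ForGeneralPoint.all t (fun D _ ↦ forGeneralPoint_apply_mem_range D)).mono
    fun p _ hp v hv s ↦ ?_
  have hv' : v ∈ Submodule.span ℂ (t : Set (RatVectorField X)) := ht ▸ hv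
  clear hv
  induction hv' using Submodule.span_induction with
  | mem x hx => exact hp x hx s
  | zero => exact zero_mem _
  | add x y _ _ hx hy => exact add_mem hx hy
  | smul c x _ hx =>
    rw [Derivation.smul_apply, Algebra.smul_def, ← algebraMap_stalkConstants p c]
    exact mul_mem ⟨_, rfl⟩ hx

end Chart

/-! ### Rational maps to affine space -/

section RationalMap

variable {X : Scheme.{0}} [IsIntegral X] [X.Over SpecC]

omit [X.Over SpecC] in
theorem RatVF.isDominant_of_isDominant_fromFunctionField {Y : Scheme.{0}} (φ : X ⤏ Y)
    [IsDominant φ.fromFunctionField] : φ.IsDominant := by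
  obtain ⟨f, rfl⟩ := φ.exists_rep
  have : f.toRationalMap.fromFunctionField = f.fromFunctionField := rfl
  have h : IsDominant f.fromFunctionField := this ▸ ‹_›
  rw [Scheme.PartialMap.isDominant_toRationalMap_iff]
  exact IsDominant.of_comp (H := h)

/-- Up to the identification of affine space with a spectrum, the morphism is dual to `aeval φ`, and
an injective ring map induces a dominant morphism. -/
theorem RatVF.homOfVector_isDominant {n : ℕ} {φ : Fin n → RatFun X}
    (hφ : Function.Injective (MvPolynomial.aeval φ : MvPolynomial (Fin n) ℂ →ₐ[ℂ] RatFun X)) :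
    IsDominant (AffineSpace.homOfVector (X.fromSpecStalk (genericPoint X) ≫ (X ↘ SpecC))
      fun i ↦ (Scheme.ΓSpecIso X.functionField).inv.hom (φ i)) := by
  have h : AffineSpace.homOfVector (X.fromSpecStalk (genericPoint X) ≫ (X ↘ SpecC))
      (fun i ↦ (Scheme.ΓSpecIso X.functionField).inv.hom (φ i)) =
      Spec.map (CommRingCat.ofHom (MvPolynomial.aeval φ : _ →ₐ[ℂ] RatFun X).toRingHom) ≫
        (AffineSpace.SpecIso (Fin n) (CommRingCat.of ℂ)).inv := by
    apply AffineSpace.hom_ext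
    · rw [AffineSpace.homOfVector_over, Category.assoc, AffineSpace.SpecIso_inv_over,
        ← Spec.map_comp, fromSpecStalk_over]
      congr 1
      ext c
      exact ((MvPolynomial.aeval_C φ c).trans rfl).symm
    · intro i
      rw [AffineSpace.homOfVector_appTop_coord, Scheme.Hom.comp_appTop, CommRingCat.comp_apply,
        AffineSpace.SpecIso_inv_appTop_coord, ← CommRingCat.comp_apply,
        ← Scheme.ΓSpecIso_inv_naturality]
      exact congrArg (Scheme.ΓSpecIso X.functionField).inv.hom (MvPolynomial.aeval_X φ i).symm
  rw [h]
  have : IsDominant (Spec.map (CommRingCat.ofHom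
      (MvPolynomial.aeval φ : MvPolynomial (Fin n) ℂ →ₐ[ℂ] RatFun X).toRingHom)) := by
    refine ⟨(PrimeSpectrum.denseRange_comap_iff_ker_le_nilRadical _).mpr ?_⟩
    exact ((RingHom.injective_iff_ker_eq_bot _).mp hφ).le.trans bot_le
  infer_instance

/-- A rational map to affine space with prescribed algebraically independent entries. -/
theorem RatVF.exists_rationalMap_entry_eq {n : ℕ} (φ : Fin n → RatFun X)
    (hφ : Function.Injective (MvPolynomial.aeval φ : MvPolynomial (Fin n) ℂ →ₐ[ℂ] RatFun X)) :
    ∃ ψ : X ⤏ 𝔸(Fin n; SpecC), ψ.IsOver SpecC ∧ entry ψ = φ ∧ ψ.IsDominant := by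
  let F : Spec X.functionField ⟶ 𝔸(Fin n; SpecC) :=
    AffineSpace.homOfVector (X.fromSpecStalk (genericPoint X) ≫ (X ↘ SpecC))
      fun i ↦ (Scheme.ΓSpecIso X.functionField).inv.hom (φ i)
  have hF : F ≫ (𝔸(Fin n; SpecC) ↘ SpecC) = X.fromSpecStalk _ ≫ (X ↘ SpecC) :=
    AffineSpace.homOfVector_over _ _
  let ψ := Scheme.RationalMap.equivFunctionField (X ↘ SpecC) (𝔸(Fin n; SpecC) ↘ SpecC) ⟨F, hF⟩
  have hψ : ψ.1.fromFunctionField = F := Scheme.RationalMap.fromFunctionField_ofFunctionField ..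
  refine ⟨ψ.1, Scheme.RationalMap.isOver_iff.mpr ψ.2, funext fun i ↦ ?_, ?_⟩
  · rw [entry, hψ]
    have : F.appTop.hom (AffineSpace.coord SpecC i) =
      (Scheme.ΓSpecIso X.functionField).inv.hom (φ i) := AffineSpace.homOfVector_appTop_coord ..
    rw [this]
    exact (Scheme.ΓSpecIso X.functionField).inv_hom_id_apply _
  · have : IsDominant ψ.1.fromFunctionField := hψ ▸ homOfVector_isDominant hφ
    exact isDominant_of_isDominant_fromFunctionField _

end RationalMap

/-! ### The ideal has dimension `n` -/

section Dimension

variable {X : Scheme.{0}} [IsIntegral X] [X.Over SpecC]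

/-- The ideal of a decomposition of affine type at a general point does not depend on the point. -/
theorem RatVF.IsOfAffineType.exists_ideal [LocallyOfFiniteType (X ↘ SpecC)]
    {g : LieSubalgebra ℂ (RatVectorField X)} (hg : IsOfAffineType g) :
    ∃ m : LieIdeal ℂ g, ForGeneralPoint fun p : X ↦ IsAffineDecomposition (isotropy g p) m := by
  obtain ⟨q, -, m, hm⟩ := ForGeneralPoint.exists_isClosed hg
  refine ⟨m, ForGeneralPoint.mono hg ?_⟩
  rintro p - ⟨m', hm'⟩
  rwa [hm.ideal_unique hm']

/-- Complex linearly independent elements of `m` are linearly independent over the function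
field. -/
theorem RatVF.linearIndependent_ratFun [LocallyOfFiniteType (X ↘ SpecC)]
    {g : LieSubalgebra ℂ (RatVectorField X)} [FiniteDimensional ℂ g] {m : LieIdeal ℂ g}
    (hm : ForGeneralPoint fun p : X ↦ IsAffineDecomposition (isotropy g p) m)
    {ι : Type*} [Fintype ι] {b : ι → m} (hb : LinearIndependent ℂ b) :
    LinearIndependent (RatFun X) fun i ↦ ((b i : g) : RatVectorField X) := by
  rw [Fintype.linearIndependent_iff]
  intro f hf k
  by_contra hk
  -- Regularity of `(f k)⁻¹` at `p` makes `f k` a unit there, so its value `c k` cannot be zero.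
  obtain ⟨p, hpc, ⟨⟨hp, hreg⟩, hinv⟩, hact⟩ := (((hm.and (ForGeneralPoint.all Finset.univ
    fun i _ ↦ forGeneralPoint_mem_range (f i))).and (forGeneralPoint_mem_range (f k)⁻¹)).and
      (forGeneralPoint_forall_apply_mem_range g)).exists_isClosed
  choose s hs using fun i ↦ hreg i (Finset.mem_univ i)
  choose c hc using fun i ↦ exists_sub_mem_maximalIdeal hpc (s i)
  -- The relation turns `∑ cᵢ bᵢ` into `∑ (cᵢ - fᵢ) bᵢ`, which vanishes at `p`; so it lies in both
  -- the isotropy and `m`.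
  have hv : ∑ i, c i • (b i : g) = 0 := by
    have hmem : ∑ i, c i • (b i : g) ∈ m.toSubmodule :=
      Submodule.sum_mem _ fun i _ ↦ m.smul_mem _ (b i).2
    refine Submodule.disjoint_def.mp hp.isCompl.disjoint _ (fun x ↦ ?_) hmem
    choose t ht using fun i ↦ hact _ (b i : g).2 x
    refine ⟨∑ i, (stalkConstants p (c i) - s i) * t i, Ideal.sum_mem _ fun i _ ↦
      Ideal.mul_mem_right _ _ (by rw [← neg_sub]; exact neg_mem (hc i)), ?_⟩
    have h0 : ∑ i, f i * ((b i : g) : RatVectorField X) (algebraMap _ (RatFun X) x) = 0 := by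
      have := congrArg (fun D : RatVectorField X ↦ D (algebraMap _ (RatFun X) x)) hf
      rw [← Derivation.coeFnAddMonoidHom_apply, map_sum, Finset.sum_apply] at this
      simpa using this
    have h1 : (((∑ i, c i • (b i : g) : g) : RatVectorField X)) =
        ∑ i, c i • ((b i : g) : RatVectorField X) := by simp
    rw [h1, ← Derivation.coeFnAddMonoidHom_apply, map_sum, Finset.sum_apply, map_sum]
    simp only [map_mul, map_sub, algebraMap_stalkConstants, hs, ht, sub_mul,
      Finset.sum_sub_distrib, h0, sub_zero]
    exact Finset.sum_congr rfl fun i _ ↦ by simp [Algebra.smul_def]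
  have hck : c k = 0 := Fintype.linearIndependent_iff.mp hb c (Subtype.ext (by simpa using hv)) k
  obtain ⟨r, hr⟩ := hinv
  have hunit : s k * r = 1 := IsFractionRing.injective (X.presheaf.stalk p) (RatFun X) (by
    rw [map_mul, hs, hr, map_one, mul_inv_cancel₀ hk])
  have := hc k
  rw [hck, map_zero, sub_zero] at this
  exact (IsLocalRing.mem_maximalIdeal _).mp this (IsUnit.of_mul_eq_one _ hunit)

/-- Linear functionals are regular at a general point, as far as fields vanishing there are
concerned. -/
theorem RatVF.forGeneralPoint_functional [Module.Finite (RatFun X) (RatVectorField X)]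
    (l : Module.Dual (RatFun X) (RatVectorField X)) :
    ForGeneralPoint fun p : X ↦ ∀ D, VanishesAt D p →
      ∃ t ∈ IsLocalRing.maximalIdeal (X.presheaf.stalk p), l D = algebraMap _ (RatFun X) t := by
  let ev : RatFun X → Module.Dual (RatFun X) (RatVectorField X) := fun x ↦
    { toFun := fun D ↦ D x
      map_add' := fun _ _ ↦ rfl
      map_smul' := fun _ _ ↦ rfl }
  -- Evaluations at functions span the dual, because a derivation killed by all of them is zero.
  have htop : Submodule.span (RatFun X) (Set.range ev) = ⊤ := by
    rw [← Subspace.dualCoannihilator_dualAnnihilator_eq (W := Submodule.span _ _)]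
    have : (Submodule.span (RatFun X) (Set.range ev)).dualCoannihilator = ⊥ := by
      rw [Submodule.eq_bot_iff]
      intro D hD
      ext x
      exact (Submodule.mem_dualCoannihilator D).mp hD _ (Submodule.subset_span ⟨x, rfl⟩)
    rw [this, Submodule.dualAnnihilator_bot]
  have hl : l ∈ Submodule.span (RatFun X) (Set.range ev) := htop ▸ Submodule.mem_top
  induction hl using Submodule.span_induction with
  | mem l hl =>
    obtain ⟨x, rfl⟩ := hl
    refine (forGeneralPoint_mem_range x).mono ?_
    rintro p - ⟨s, rfl⟩ D hD
    exact hD s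
  | zero => exact forGeneralPoint_of_forall fun p D _ ↦ ⟨0, zero_mem _, by simp⟩
  | add l l' _ _ hl hl' =>
    refine (hl.and hl').mono fun p _ hp D hD ↦ ?_
    obtain ⟨t, ht, h⟩ := hp.1 D hD
    obtain ⟨t', ht', h'⟩ := hp.2 D hD
    exact ⟨t + t', add_mem ht ht', by simp [h, h']⟩
  | smul a l _ hl =>
    refine (hl.and (forGeneralPoint_mem_range a)).mono ?_
    rintro p - ⟨hp, s, hs⟩ D hD
    obtain ⟨t, ht, h⟩ := hp D hD
    exact ⟨s * t, Ideal.mul_mem_left _ _ ht, by rw [map_mul, ← h, hs]; rfl⟩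

theorem RatVF.IsTransitive.exists_basis [Module.Finite (RatFun X) (RatVectorField X)]
    {g : LieSubalgebra ℂ (RatVectorField X)} (hg : IsTransitive g) :
    ∃ W : Module.Basis (Fin (Module.finrank (RatFun X) (RatVectorField X))) (RatFun X)
      (RatVectorField X), ∀ i, W i ∈ g := by
  let W := Module.Basis.ofSpan (top_le_iff.mpr hg)
  have := Module.Finite.finite_basis W
  refine ⟨W.reindex (Finite.equivFinOfCardEq (Module.finrank_eq_nat_card_basis W).symm),
    fun i ↦ ?_⟩
  rw [Module.Basis.reindex_apply]
  exact Module.Basis.ofSpan_subset _ ⟨_, rfl⟩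

/-- For a transitive Lie algebra, the dimension of a complement of the isotropy at a general point
is at least the dimension of the space of all vector fields. -/
theorem RatVF.finrank_le_finrank_ideal [LocallyOfFiniteType (X ↘ SpecC)]
    [Module.Finite (RatFun X) (RatVectorField X)]
    {g : LieSubalgebra ℂ (RatVectorField X)} [FiniteDimensional ℂ g] (hg : IsTransitive g)
    {m : LieIdeal ℂ g}
    (hm : ForGeneralPoint fun p : X ↦ IsAffineDecomposition (isotropy g p) m) :
    Module.finrank (RatFun X) (RatVectorField X) ≤ Module.finrank ℂ m := by
  obtain ⟨W, hW⟩ := hg.exists_basis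
  obtain ⟨p, hpc, hp, hcoord⟩ := (hm.and (ForGeneralPoint.all Finset.univ
    fun i _ ↦ forGeneralPoint_functional (W.coord i))).exists_isClosed
  have hlocal : IsLocalRing.maximalIdeal (X.presheaf.stalk p) ≠ ⊤ := Ideal.IsPrime.ne_top'
  -- The complex span of the frame `W` meets the isotropy at `p` only in zero, so it embeds into `m`
  -- under the projection along the isotropy.
  let T : (Fin (Module.finrank (RatFun X) (RatVectorField X)) → ℂ) →ₗ[ℂ] g :=
    Fintype.linearCombination ℂ fun i ↦ (⟨W i, hW i⟩ : g)
  have hT : ∀ c, T c ∈ isotropy g p → c = 0 := by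
    intro c hc
    funext i
    obtain ⟨t, ht, h⟩ := hcoord i (Finset.mem_univ i) _ hc
    have h1 : ((T c : g) : RatVectorField X) = ∑ j, algebraMap ℂ (RatFun X) (c j) • W j := by
      simp [T, Fintype.linearCombination_apply]
    rw [h1, Module.Basis.coord_apply, W.repr_sum_self, ← algebraMap_stalkConstants p] at h
    have h2 := IsFractionRing.injective (X.presheaf.stalk p) (RatFun X) h
    by_contra hne
    refine hlocal (Ideal.eq_top_of_isUnit_mem _ (h2 ▸ ht) ?_)
    exact (IsUnit.mk0 _ hne).map (stalkConstants p)
  let π := Submodule.projectionOnto m.toSubmodule (isotropy g p).toSubmodule hp.isCompl.symm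
  have := LinearMap.finrank_le_finrank_of_injective (f := π ∘ₗ T) (by
    rw [injective_iff_map_eq_zero]
    intro c hc
    have : T c ∈ LinearMap.ker π := hc
    rw [Submodule.ker_projectionOnto] at this
    exact hT c this)
  rwa [Module.finrank_fin_fun] at this

end Dimension

/-! ### The main theorem -/

theorem mainTheorem3 (n : ℕ) (X : Scheme.{0}) [IsIntegral X] [X.Over SpecC]
    [SmoothOfRelativeDimension n (X ↘ SpecC)] (hX : RatVF.IsProjective X)
    (g : LieSubalgebra ℂ (RatVectorField X)) (hprim : RatVF.IsPrimitive g)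
    (hna : ¬ IsLieAbelian g) (haff : IsOfAffineType g) :
    ∃ m : LieIdeal ℂ g,
      ForGeneralPoint (fun p : X => IsAffineDecomposition (isotropy g p) m) ∧
      Module.finrank ℂ m = n ∧
      ∀ b : Module.Basis (Fin n) ℂ m,
        (1 : RatFun X) ∈ wedgeQuotients g b ∧
        Module.finrank ℂ (wedgeQuotients g b) = n + 1 ∧
        (∀ v ∈ g, ∀ f ∈ wedgeQuotients g b, v f ∈ wedgeQuotients g b) ∧
        ∃ φ : X ⤏ 𝔸(Fin n; SpecC), φ.IsOver SpecC ∧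
          wedgeQuotients g b = Submodule.span ℂ (insert 1 (Set.range (entry φ))) ∧
          ∃ a : LieSubalgebra ℂ (PolyVectorField n),
            (∀ D ∈ a, PolyVectorField.DegreeLE D 1) ∧ Conjugates φ g a := by
  have : Smooth (X ↘ SpecC) := SmoothOfRelativeDimension.smooth n _
  have : FiniteDimensional ℂ g := hprim.finiteDimensional
  obtain ⟨hdim, _, _⟩ := finrank_ratVectorField n X
  obtain ⟨m, hm⟩ := haff.exists_ideal
  obtain ⟨q, -, hq⟩ := hm.exists_isClosed
  have hfin : Module.finrank ℂ m = n := by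
    refine le_antisymm ?_ (hdim ▸ finrank_le_finrank_ideal hprim.transitive hm)
    have := (linearIndependent_ratFun hm
      (Module.finBasis ℂ m).linearIndependent).fintype_card_le_finrank
    rwa [Fintype.card_fin, hdim] at this
  -- For `n = 0` there are no nonzero vector fields and `g` would be abelian.
  have hn : 0 < n := by
    rw [Nat.pos_iff_ne_zero]
    rintro rfl
    have : Subsingleton (RatVectorField X) := Module.finrank_zero_iff.mp hdim
    exact hna ⟨fun x y ↦ Subsingleton.elim _ _⟩
  refine ⟨m, hm, hfin, fun b ↦ ?_⟩
  have : Nonempty (Fin n) := ⟨⟨0, hn⟩⟩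
  let B : Module.Basis (Fin n) (RatFun X) (RatVectorField X) :=
    basisOfLinearIndependentOfCardEqFinrank (linearIndependent_ratFun hm b.linearIndependent)
      (by rw [Fintype.card_fin, hdim])
  have hB : ∀ i, B i = ((b i : g) : RatVectorField X) := fun i ↦ by
    simp [B]
  have hK := exists_algebraMap_eq_of_forall_derivation_eq_zero (K := RatFun X)
  have hab := hq.abelian
  rw [wedgeQuotients_eq_coordinateSpan hn g b B hB]
  obtain ⟨φ, hφ, hdual⟩ := exists_dual_mem_coordinateSpan hB hab
    (fun I hI ↦ hq.eq_bot_or_eq hI) hna hK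
  have hspan := coordinateSpan_eq_span hB hab hK hn hφ hdual
  have hinj := aeval_injective_of_derivation_dual hdual
  obtain ⟨a, ha, e, he⟩ := exists_lieEquiv_of_invariant_span g hinj
    -- Faithfulness: since `φ` is dual to `B`, the `i`-th coordinate of `v` is `v (φ i)`.
    (fun v hv i ↦ hspan ▸ apply_mem_coordinateSpan hB hab hv (hφ i)) (fun v hv h ↦ by
      rw [← B.sum_repr v]
      refine Finset.sum_eq_zero fun i _ ↦ ?_
      have := h i
      rw [← B.sum_repr v, ← Derivation.coeFnAddMonoidHom_apply, map_sum, Finset.sum_apply] at this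
      rw [show B.repr v i = 0 by simpa [hdual] using this, zero_smul])
  obtain ⟨ψ, hψ, hentry, hdom⟩ := exists_rationalMap_entry_eq φ hinj
  refine ⟨one_mem_coordinateSpan hB hn, ?_,
    fun v hv f hf ↦ apply_mem_coordinateSpan hB hab hv hf, ψ, hψ, hentry ▸ hspan, a, ha, hdom, e,
    fun v P ↦ ?_⟩
  · rw [hspan]
    exact finrank_span_insert_one hdual
  · rw [pullback, hentry]
    exact he v P
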